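/- \textbf{Conventions.} A (set-theoretic) solution is a pair $(X,r)$ with $X\neq\emptyset$ and $r\colon X\times X\to X\times X$ satisfying $(r\times\mathrm{id})(\mathrm{id}\times r)(r\times\mathrm{id})=(\mathrm{id}\times r)(r\times\mathrm{id})(\mathrm{id}\times r)$. Write $r(x,y)=(\lambda_x(y),\rho_y(x))$. It is non-degenerate if $r$ and all $\lambda_x,\rho_y$ are bijective; it is then irretractable if $x\mapsto(\sigma_x,\lambda_x)$ is injective on $X$, where $\sigma_y(x)=\lambda_y\rho_{\lambda_x^{-1}(y)}(x)$. It is simple if $|X|>1$ and each of its epimorphic images is a singleton or isomorphic to $(X,r)$. A skew left brace is a set $B$ with two group structures $(B,+)$, $(B,\circ)$ (neither necessarily abelian) such that $a\circ(b+c)=a\circ b-a+a\circ c$. Put $\lambda_a(b)=-a+a\circ b$, $\sigma_a(b)=-a+b+a$, $a*b=\lambda_a(b)-b$, and $r_B(a,b)=(\lambda_a(b),\lambda_a(b)^{-1}\circ a\circ b)$, the inverse being taken in $(B,\circ)$. An ideal of $B$ is a subset that is a normal subgroup of both $(B,+)$ and $(B,\circ)$ and is invariant under all $\lambda_a$. $B^{(2)}$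 is the additive subgroup generated by all $a*b$ with $a,b\in B$, and $B^{(3)}$ the one generated by all $a*b$ with $a\in B^{(2)}$, $b\in B$. \textbf{Theorem.} Assume that: \begin{itemize} \item $V$ is an elementary abelian $p$-group of order $p^n$ ($p$ prime, $n\ge1$); \item $C=\langle x\rangle$ is a cyclic group of order $k>1$; \item $A,A'\in\mathrm{Aut}(V)$ commute, have orders dividing $\gcd(k,p^n-1)$, and $A\ne1$; $u_0\in V$ and $v_1=u_0-Au_0$; moreover $k=o(A)$ if $A'=1$ and $v_1=0$; $k=o(A)p$ if $A'=1$ and $v_1\neq0$; $k=\mathrm{lcm}(o(A),o(A'))$ if $A'\neq1$; \item $V$ is a simple $\mathcal R$-module, where $\mathcal R$ is the subring of $\mathrm{End}(V)$ generated by $A$ and $A'$. \end{itemize} Then $\mathcal R$ is a field with $p^n$ elements. Let $(B,+)=V\rtimes C$ with $x+v-x=Av$ for $v\in V$, write each $a\in B$ uniquely as $a=v+ix$ with $v\in V$, $0\le i<k$, put $|a|=i$, and let $a\circ b=a+\lambda^{|a|}(b)$, where $\lambda(v+ix)=A'v+u_0-A^iu_0+ix$. Then $(B,+,\circ)$ is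 a skew left brace. The solution $(B,r_B)$ restricts to a finite non-degenerate irretractable simple solution $(X,r)$ on $X=\{v+x-v:v\in V\}$, which is the conjugacy class of $x$ in $(B,+)$. Further, $X=V+x$ and, for all $v,w\in V$, \[r(v+x,w+x)=\bigl(A'w+v_1+x,\;-A^{-1}w+(AA')^{-1}(v-v_1)+w+x\bigr).\] Conversely, let $B$ be a finite skew left brace, $X\subseteq B$ and $V\subseteq B$ such that: $r_B$ restricts to a non-degenerate, irretractable, simple solution on $X$; $X$ generates $(B,+)$; $V$ is the smallest non-zero ideal of $B$; $B/V$ is a trivial skew left brace (its two operations coincide) with cyclic additive group; and $V$ acts transitively on $X$, that is, $\sigma_a\lambda_b(y)\in X$ for all $a,b\in V$, $y\in X$, and for all $y,z\in X$ there are $a,b\in V$ with $\sigma_a\lambda_b(y)=z$. Suppose moreover that $B^{(3)}=0$ and that $V$ is abelian. Then $B$, $V$ and $X$ arise as above: for every $x_0\in X$ there are data $(p,n,k,W,A,A',u_0)$ satisfying all the listed assumptions, with $W$ in the role of $V$, and an isomorphism from $B$ to the skew left brace constructed from them that maps $V$ onto $W$, $X$ onto $W+x$ and $x_0$ to $x$.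 -/

import Mathlib

universe u

namespace YBE

section Solutions

variable {X : Type u}

/-- `r × id` on `X × X × X`. -/
def r12 (r : X × X → X × X) (t : X × X × X) : X × X × X :=
  ((r (t.1, t.2.1)).1, (r (t.1, t.2.1)).2, t.2.2)

/-- `id × r` on `X × X × X`. -/
def r23 (r : X × X → X × X) (t : X × X × X) : X × X × X :=
  (t.1, r t.2)

/-- `(X, r)` is a set-theoretic solution of the Yang--Baxter equation: `X` is non-empty and `r`
satisfies the braid equation. -/
structure IsSolution (r : X × X → X × X) : Prop where
  nonempty : Nonempty X
  braid : ∀ t, r12 r (r23 r (r12 r t)) = r23 r (r12 r (r23 r t))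

/-- `lamMap r x y = λ_x(y)`, where `r (x, y) = (λ_x(y), ρ_y(x))`. -/
def lamMap (r : X × X → X × X) (x y : X) : X := (r (x, y)).1

/-- `rhoMap r y x = ρ_y(x)`, where `r (x, y) = (λ_x(y), ρ_y(x))`. -/
def rhoMap (r : X × X → X × X) (y x : X) : X := (r (x, y)).2

/-- A (bijective) non-degenerate solution: all `λ_x` and `ρ_y` are bijections, and so is `r`. -/
structure IsNondegSolution (r : X × X → X × X) : Prop extends IsSolution r where
  bijective : Function.Bijective r
  lam_bijective : ∀ x, Function.Bijective (lamMap r x)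
  rho_bijective : ∀ y, Function.Bijective (rhoMap r y)

/-- `σ_y(x) = λ_y ρ_{λ_x⁻¹(y)}(x)`, the map of the left derived solution. -/
noncomputable def sigmaMap {r : X × X → X × X} (h : IsNondegSolution r) (y x : X) : X :=
  lamMap r y (rhoMap r ((Equiv.ofBijective (lamMap r x) (h.lam_bijective x)).symm y) x)

/-- A non-degenerate solution is irretractable if the pair `(σ_x, λ_x)` determines `x`. -/
def IsIrretractable {r : X × X → X × X} (h : IsNondegSolution r) : Prop :=
  Function.Injective fun x : X => (sigmaMap h x, lamMap r x)

/-- Morphisms of solutions. -/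
def IsMorphism {Y : Type u} (r : X × X → X × X) (s : Y × Y → Y × Y) (f : X → Y) : Prop :=
  ∀ x y, s (f x, f y) = (f (r (x, y)).1, f (r (x, y)).2)

/-- A simple solution: a solution with more than one element, each of whose epimorphic images is
either a singleton or isomorphic to it. -/
structure IsSimpleSolution (r : X × X → X × X) : Prop extends IsSolution r where
  nontrivial : Nontrivial X
  image : ∀ (Y : Type u) (s : Y × Y → Y × Y) (f : X → Y), IsSolution s → IsMorphism r s f →
    Function.Surjective f → Subsingleton Y ∨ ∃ e : X ≃ Y, IsMorphism r s e

/-- The map `r` restricts to the subset `Z`. -/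
def RestrictsTo (r : X × X → X × X) (Z : Set X) : Prop :=
  ∀ x ∈ Z, ∀ y ∈ Z, (r (x, y)).1 ∈ Z ∧ (r (x, y)).2 ∈ Z

/-- The restriction of `r` to the subset `Z`. -/
def restr (r : X × X → X × X) {Z : Set X} (h : RestrictsTo r Z) (t : Z × Z) : Z × Z :=
  (⟨(r (t.1, t.2)).1, (h t.1 t.1.2 t.2 t.2.2).1⟩, ⟨(r (t.1, t.2)).2, (h t.1 t.1.2 t.2 t.2.2).2⟩)

end Solutions

/-- A skew left brace: `+` is the additive group, and `*` stands for the operation `∘` of the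
multiplicative group. -/
class SkewLeftBrace (B : Type u) [AddGroup B] extends Group B where
  mul_add_eq : ∀ a b c : B, a * (b + c) = a * b - a + a * c

section Brace

variable {B : Type u} [AddGroup B] [SkewLeftBrace B]

/-- `λ_a(b) = -a + a ∘ b`. -/
def lam (a b : B) : B := -a + a * b

/-- `σ_a(b) = -a + b + a`. -/
def sig (a b : B) : B := -a + b + a

/-- The operation `λ_a(b) - b = -a + a ∘ b - b`, usually written `a * b`. -/
def star (a b : B) : B := -a + a * b - b

/-- The associated solution `r_B(a, b) = (λ_a(b), λ_a(b)⁻¹ ∘ a ∘ b)`, the inverse being taken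
in the multiplicative group. -/
def rB (t : B × B) : B × B := (lam t.1 t.2, (lam t.1 t.2)⁻¹ * t.1 * t.2)

/-- Ideals: additive subgroups that are normal in `(B, +)`, invariant under all `λ_a`, and
normal subgroups of `(B, ∘)`. -/
structure IsIdeal (I : AddSubgroup B) : Prop where
  normal : I.Normal
  lam_mem : ∀ a : B, lam a '' (I : Set B) = I
  mul_normal : ∃ N : Subgroup B, N.Normal ∧ (N : Set B) = I

/-- `V` is the smallest non-zero ideal. -/
structure IsSmallestIdeal (V : AddSubgroup B) : Prop where
  isIdeal : IsIdeal V
  ne_bot : V ≠ ⊥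
  le : ∀ I : AddSubgroup B, IsIdeal I → I ≠ ⊥ → V ≤ I

variable (B) in
/-- `B⁽²⁾ = B * B`. -/
def B2 : AddSubgroup B := AddSubgroup.closure {c | ∃ a b : B, c = star a b}

variable (B) in
/-- `B⁽³⁾ = B⁽²⁾ * B`. -/
def B3 : AddSubgroup B := AddSubgroup.closure {c | ∃ a ∈ B2 B, ∃ b : B, c = star a b}

/-- The ideal `V` acts on `X`, through `(a, b) · x = σ_a λ_b(x)` for `a, b ∈ V`, and this action is
transitive. -/
structure ActsTransitively (V : AddSubgroup B) (X : Set B) : Prop where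
  mem : ∀ a ∈ V, ∀ b ∈ V, ∀ x ∈ X, sig a (lam b x) ∈ X
  trans : ∀ x ∈ X, ∀ y ∈ X, ∃ a ∈ V, ∃ b ∈ V, sig a (lam b x) = y

/-- The subset `X` of `B` carries a non-degenerate irretractable subsolution of `(B, r_B)`, it
generates `(B, +)`, `V` is the smallest non-zero ideal of `B`, the quotient `B / V` is a trivial
skew left brace of cyclic type, and `V` acts transitively on `X`. -/
structure IsTypeTwo (X : Set B) (V : AddSubgroup B) : Prop where
  restricts : RestrictsTo rB X
  nondeg : IsNondegSolution (restr rB restricts)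
  irretractable : IsIrretractable nondeg
  generates : AddSubgroup.closure X = ⊤
  smallest : IsSmallestIdeal V
  quot_trivial : ∀ a b : B, ((a * b : B) : B ⧸ V) = ((a + b : B) : B ⧸ V)
  quot_cyclic : ∃ g : B, ∀ b : B, ∃ m : ℤ, (b : B ⧸ V) = ((m • g : B) : B ⧸ V)
  transitive : ActsTransitively V X

end Brace

/-- The automorphism group of the abelian group `V`, with composition as multiplication: the group of
units of the endomorphism ring. The value of `A` at `v` is written `A • v`. -/
abbrev Aut (V : Type u) [AddCommGroup V] : Type u := (AddMonoid.End V)ˣ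

/-- The subring of `End(V)` generated by two automorphisms. -/
def genRing {V : Type u} [AddCommGroup V] (A A' : Aut V) : Subring (AddMonoid.End V) :=
  Subring.closure {(A : AddMonoid.End V), (A' : AddMonoid.End V)}

/-- The input of the construction: an elementary abelian `p`-group `V` of order `p ^ n`, an integer
`k > 1`, automorphisms `A`, `A'` of `V` and an element `u₀ ∈ V`, subject to the conditions below. -/
structure Datum (V : Type u) [AddCommGroup V] (p n k : ℕ) where
  A : Aut V
  A' : Aut V
  u₀ : V
  prime : p.Prime
  one_le_n : 1 ≤ n
  card_eq : Nat.card V = p ^ n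
  elementary : ∀ v : V, p • v = 0
  one_lt_k : 1 < k
  comm : A * A' = A' * A
  order_A : orderOf A ∣ Nat.gcd k (p ^ n - 1)
  order_A' : orderOf A' ∣ Nat.gcd k (p ^ n - 1)
  A_ne_one : A ≠ 1
  k_eq₁ : A' = 1 → u₀ - A • u₀ = 0 → k = orderOf A
  k_eq₂ : A' = 1 → u₀ - A • u₀ ≠ 0 → k = orderOf A * p
  k_eq₃ : A' ≠ 1 → k = Nat.lcm (orderOf A) (orderOf A')
  simple : IsSimpleModule (genRing A A') V

namespace Datum

variable {V : Type u} [AddCommGroup V] {p n k : ℕ} (D : Datum V p n k)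

/-- `v₁ = u₀ - A u₀`. -/
def v₁ : V := D.u₀ - D.A • D.u₀

theorem A_pow_k : D.A ^ k = 1 :=
  orderOf_dvd_iff_pow_eq_one.mp (D.order_A.trans (Nat.gcd_dvd_left _ _))

/-- The underlying set of `V ⋊ C`, with `C = ℤ/k` cyclic of order `k`. The pair `(v, i)` is the
element `v + i x`, where `x` is the generator `1` of `C`. -/
@[ext]
structure Carrier (D : Datum V p n k) : Type u where
  vec : V
  idx : ZMod k

variable {D}

/-- `|a|`, the representative of the `C`-component in `{0, …, k - 1}`. -/
def Carrier.deg (a : D.Carrier) : ℕ := a.idx.val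

theorem A_pow_val_add (i j : ZMod k) (v : V) :
    (D.A ^ (i + j).val) • v = (D.A ^ i.val) • ((D.A ^ j.val) • v) := by
  have : NeZero k := ⟨by have := D.one_lt_k; omega⟩
  rw [ZMod.val_add, ← pow_eq_pow_mod _ D.A_pow_k, pow_add, mul_smul]

theorem A_pow_val_zero (v : V) : (D.A ^ (0 : ZMod k).val) • v = v := by
  rw [ZMod.val_zero, pow_zero, one_smul]

instance : Add D.Carrier := ⟨fun a b => ⟨a.vec + (D.A ^ a.idx.val) • b.vec, a.idx + b.idx⟩⟩

instance : Zero D.Carrier := ⟨⟨0, 0⟩⟩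

instance : Neg D.Carrier := ⟨fun a => ⟨-(D.A ^ (-a.idx).val) • a.vec, -a.idx⟩⟩

theorem Carrier.add_def (a b : D.Carrier) :
    a + b = ⟨a.vec + (D.A ^ a.idx.val) • b.vec, a.idx + b.idx⟩ := rfl

theorem Carrier.zero_def : (0 : D.Carrier) = ⟨0, 0⟩ := rfl

theorem Carrier.neg_def (a : D.Carrier) :
    -a = ⟨-(D.A ^ (-a.idx).val) • a.vec, -a.idx⟩ := rfl

/-- The additive group `V ⋊ C`, in which `x + v - x = A v` for `v ∈ V`. -/
instance : AddGroup D.Carrier :=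
  AddGroup.ofLeftAxioms
    (by
      intro a b c
      ext
      · simp [Carrier.add_def, A_pow_val_add, add_assoc]
      · simp [Carrier.add_def, add_assoc])
    (by
      intro a
      ext
      · simp only [Carrier.add_def, Carrier.zero_def, A_pow_val_zero, zero_add]
      · simp [Carrier.add_def, Carrier.zero_def])
    (by
      intro a
      ext
      · simp [Carrier.add_def, Carrier.zero_def, Carrier.neg_def]
      · simp [Carrier.add_def, Carrier.zero_def, Carrier.neg_def])

variable (D)

/-- The embedding of `V` into `V ⋊ C`. -/
def inV (v : V) : D.Carrier := ⟨v, 0⟩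

/-- The generator `x` of `C`, as an element of `V ⋊ C`. -/
def x : D.Carrier := ⟨0, 1⟩

theorem inV_add (v w : V) : D.inV (v + w) = D.inV v + D.inV w := by
  ext
  · simp only [inV, Carrier.add_def, A_pow_val_zero]
  · simp [inV, Carrier.add_def]

theorem x_conj (v : V) : D.x + D.inV v - D.x = D.inV (D.A • v) := by
  have : Fact (1 < k) := ⟨D.one_lt_k⟩
  rw [sub_eq_iff_eq_add]
  ext
  · simp [x, inV, Carrier.add_def, ZMod.val_one]
  · simp [x, inV, Carrier.add_def]

theorem nsmul_x (i : ℕ) : i • D.x = ⟨0, (i : ZMod k)⟩ := by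
  induction i with
  | zero => simp [Carrier.zero_def]
  | succ i ih =>
    rw [succ_nsmul, ih]
    ext <;> simp [x, Carrier.add_def]

theorem eq_inV_add_nsmul (a : D.Carrier) : a = D.inV a.vec + a.deg • D.x := by
  have : NeZero k := ⟨by have := D.one_lt_k; omega⟩
  rw [nsmul_x]
  ext
  · simp [inV, Carrier.add_def]
  · simp [inV, Carrier.add_def, Carrier.deg]

/-- `λ(v + i x) = A' v + u₀ - A ^ i u₀ + i x`, for `0 ≤ i < k`. -/
def lambda (a : D.Carrier) : D.Carrier :=
  D.inV (D.A' • a.vec + D.u₀ - (D.A ^ a.deg) • D.u₀) + a.deg • D.x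

/-- `a ∘ b = a + λ ^ |a| (b)`. -/
def circ (a b : D.Carrier) : D.Carrier := a + D.lambda^[a.deg] b

/-- `X = {v + x - v : v ∈ V}`. -/
def X : Set D.Carrier := {a | ∃ v : V, a = D.inV v + D.x - D.inV v}

end Datum

end YBE

/-!
The starting point is Schur's lemma. If `A` and `A'` commute and `V` is simple over the commutative
ring `R` that they generate, then non-zero elements of `R` act bijectively, and evaluation at a
non-zero vector is a bijection from `R` onto `V`; so `R` is a field with `|V|` elements
(`genRing_isField`, `card_genRing`). In particular `1 - A` and `1 - A⁻¹` are invertible, and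
`∑ A' ^ j = 0` over a full period when `A' ≠ 1`.

*From data to solutions.* The map `λ` is an automorphism of `V ⋊ C` that preserves `|·|`, and the
conditions on `k` give `λ ^ k = 1` (`Datum.iterate_lambda_k`), so `∘` is a group law. On
`X = V + x ≃ V` the solution becomes the affine map `(v, w) ↦ (L w + c, w + N (v - (L w + c)))` with
`L = A'`, `N = (A A')⁻¹`, `c = v₁`, for which the braid relation and non-degeneracy are direct
computations. Since `σ_y (v) = y + A⁻¹ (v - y)` and `1 - A⁻¹` is invertible, it is irretractable.
For simplicity, consider a morphism `g` to another solution. The maps `v ↦ L v + c` and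
`v ↦ y + A⁻¹ (v - y)` preserve the partition of `V` into fibres of `g`; by finiteness so do the
inverses of the latter, hence all translations. So the fibres are the cosets of an `R`-submodule of
`V`, which is `0` or `V` (`affineMap_constant_or_injective`).

*From solutions to data.* In a skew left brace `B⁽²⁾` is an ideal (`isIdeal_B2`). If `B⁽³⁾ = 0`,
then `λ_v = 1` for all `v` in the smallest ideal `V` (`IsSmallestIdeal.lam_eq`), because either
`B⁽²⁾ = 0` or `V ⊆ B⁽²⁾`. As `B / V` is trivial, `λ` is then a homomorphism on `(B, +)`.
Transitivity makes `X` the `V`-conjugacy class of `x₀`, so `B = V + ⟨x₀⟩`. Let `A` and `A'` be the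
actions on `V` of conjugation by `x₀` and of `λ_{x₀}`. Subgroups of `V` stable under both are
ideals of `B` (`LinearBrace.isIdeal_map`), so minimality of `V` makes it elementary abelian and a
simple module. As `X` is not a point, `A ≠ 1`; so `A` has no non-zero fixed points,
`V ∩ ⟨x₀⟩ = 0`, and `λ_{x₀}(x₀) = u₀ - A u₀ + x₀` for some `u₀`. The order `k` of `x₀` is the
expected one because a central multiple `m x₀` that is fixed by all `λ_b`, and has `λ_{m x₀} = 1`,
spans an ideal that meets `V` trivially, and hence is zero (`LinearBrace.nsmul_x₀_eq_zero`).
-/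

namespace YBE

/-! ### The ring generated by two commuting automorphisms -/

section GenRing

variable {V : Type u} [AddCommGroup V] {A A' : Aut V}

theorem coe_mem_genRing : (A : AddMonoid.End V) ∈ genRing A A' :=
  Subring.subset_closure (by simp)

theorem coe_mem_genRing' : (A' : AddMonoid.End V) ∈ genRing A A' :=
  Subring.subset_closure (by simp)

theorem genRing_mul_comm (h : A * A' = A' * A) (r s : genRing A A') : r * s = s * r := by
  have h' : (A : AddMonoid.End V) * A' = A' * A := by
    rw [← Units.val_mul, h, Units.val_mul]
  refine (Subring.isMulCommutative_closure (s := {(A : AddMonoid.End V), (A' : AddMonoid.End V)})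
    ?_).is_comm.comm r s
  rintro a (rfl | rfl) b (rfl | rfl)
  exacts [rfl, h', h'.symm, rfl]

/-- An additive subgroup stable under `A` and `A'` is a submodule over the ring they generate. -/
def submoduleOfStable (U : AddSubgroup V) (hA : ∀ v ∈ U, A • v ∈ U) (hA' : ∀ v ∈ U, A' • v ∈ U) :
    Submodule (genRing A A') V :=
  { U with
    smul_mem' := by
      rintro ⟨r, hr⟩ v hv
      change r v ∈ U
      change v ∈ U at hv
      induction hr using Subring.closure_induction generalizing v with
      | mem r hr =>
        rcases hr with rfl | rfl
        exacts [hA v hv, hA' v hv]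
      | zero => exact U.zero_mem
      | one => exact hv
      | add r s _ _ hr hs => exact U.add_mem (hr hv) (hs hv)
      | neg r _ hr => exact U.neg_mem (hr hv)
      | mul r s _ _ hr hs => exact hr (hs hv) }

variable (hs : IsSimpleModule (genRing A A') V)

include hs in
theorem exists_ne_zero_of_isSimpleModule : ∃ v : V, v ≠ 0 :=
  have := IsSimpleModule.nontrivial (genRing A A') V
  exists_ne 0

include hs in
/-- Schur's lemma: the generated ring is commutative, so its elements act as module
endomorphisms. -/
theorem genRing_bijective (h : A * A' = A' * A) (r : genRing A A') (hr : r ≠ 0) :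
    Function.Bijective fun v : V => r • v := by
  let f : V →ₗ[genRing A A'] V :=
    { toFun := fun v => r • v
      map_add' := smul_add r
      map_smul' := fun s v => by
        simp only [RingHom.id_apply, smul_smul, genRing_mul_comm h r s] }
  refine (LinearMap.bijective_or_eq_zero f).resolve_right fun hf => hr ?_
  ext v
  exact LinearMap.congr_fun hf v

include hs in
/-- As the ring acts through injective maps, evaluation at a non-zero vector identifies it with
`V`. -/
theorem genRing_eval_bijective (h : A * A' = A' * A) {v : V} (hv : v ≠ 0) :
    Function.Bijective fun r : genRing A A' => r • v := by
  constructor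
  · intro r s hrs
    by_contra hne
    refine hv ((genRing_bijective hs h (r - s) (sub_ne_zero.2 hne)).1 ?_)
    simpa [sub_smul, sub_eq_zero] using hrs
  · exact IsSimpleModule.toSpanSingleton_surjective (genRing A A') hv

include hs in
theorem genRing_isField (h : A * A' = A' * A) : IsField (genRing A A') := by
  obtain ⟨v, hv⟩ := exists_ne_zero_of_isSimpleModule hs
  have hev := genRing_eval_bijective hs h hv
  refine ⟨⟨0, 1, fun h01 => hv ?_⟩, genRing_mul_comm h, fun {r} hr => ?_⟩
  · rw [← one_smul (genRing A A') v, ← h01, zero_smul]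
  · have hrv : r • v ≠ 0 := fun h0 => hr (hev.1 (by simpa using h0))
    obtain ⟨s, hs⟩ := (genRing_eval_bijective hs h hrv).2 v
    refine ⟨s, ?_⟩
    rw [genRing_mul_comm h]
    refine hev.1 ?_
    simpa [mul_smul] using hs

include hs in
theorem card_genRing (h : A * A' = A' * A) : Nat.card (genRing A A') = Nat.card V := by
  obtain ⟨v, hv⟩ := exists_ne_zero_of_isSimpleModule hs
  exact Nat.card_eq_of_bijective _ (genRing_eval_bijective hs h hv)

include hs in
theorem orderOf_dvd_of_mem_genRing [Finite V] (h : A * A' = A' * A) (C : Aut V)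
    (hC : (C : AddMonoid.End V) ∈ genRing A A') : orderOf C ∣ Nat.card V - 1 := by
  have hfin : Finite (genRing A A') := by
    obtain ⟨v, hv⟩ := exists_ne_zero_of_isSimpleModule hs
    exact Finite.of_injective _ (genRing_eval_bijective hs h hv).1
  have := Fintype.ofFinite (genRing A A')
  let _ := (genRing_isField hs h).toField
  have hne : (⟨C, hC⟩ : genRing A A') ≠ 0 := by
    obtain ⟨v, hv⟩ := exists_ne_zero_of_isSimpleModule hs
    intro h0
    have h1 : C • v = 0 := DFunLike.congr_fun (congrArg Subtype.val h0) v
    exact hv ((smul_eq_zero_iff_eq C).1 h1)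
  have hp := FiniteField.pow_card_sub_one_eq_one _ hne
  rw [← Nat.card_eq_fintype_card, card_genRing hs h] at hp
  refine orderOf_dvd_of_pow_eq_one (Units.ext ?_)
  simpa using congrArg Subtype.val hp

include hs in
theorem one_sub_bijective (h : A * A' = A' * A) (C : Aut V)
    (hC : (C : AddMonoid.End V) ∈ genRing A A') (hC1 : C ≠ 1) :
    Function.Bijective fun v : V => v - C • v := by
  refine genRing_bijective hs h ⟨1 - C, sub_mem (one_mem _) hC⟩ fun h0 => hC1 ?_
  have : (1 : AddMonoid.End V) - C = 0 := congrArg Subtype.val h0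
  exact Units.ext (sub_eq_zero.1 this).symm

include hs in
theorem sum_pow_smul_eq_zero (h : A * A' = A' * A) (hA' : A' ≠ 1) {m : ℕ} (hm : A' ^ m = 1)
    (v : V) : ∑ j ∈ Finset.range m, A' ^ j • v = 0 := by
  apply (one_sub_bijective hs h A' coe_mem_genRing' hA').1
  simp only [Finset.smul_sum, smul_smul, ← pow_succ', smul_zero, sub_zero]
  rw [← Finset.sum_sub_distrib, Finset.sum_range_sub', hm, pow_zero, sub_self]

end GenRing

/-! ### Affine solutions -/

section Affine

variable {V : Type u} [AddCommGroup V]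

/-- The affine map `(v, w) ↦ (L w + c, w + N (v - (L w + c)))` on `V × V`: the solution on
`X = V + x` in the coordinate `v`, for `L = A'`, `N = (A A')⁻¹` and `c = v₁`. Writing it in terms of
`L` and `N` alone avoids inverses in the braid relation. -/
def affineMap (L N : Aut V) (c : V) (t : V × V) : V × V :=
  (L • t.2 + c, t.2 + N • (t.1 - (L • t.2 + c)))

theorem affineMap_braid {L N : Aut V} (h : L * N = N * L) (c : V) (t : V × V × V) :
    r12 (affineMap L N c) (r23 (affineMap L N c) (r12 (affineMap L N c) t)) =
      r23 (affineMap L N c) (r12 (affineMap L N c) (r23 (affineMap L N c) t)) := by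
  have hc (v : V) : N • L • v = L • N • v := by rw [smul_smul, smul_smul, h]
  obtain ⟨u, v, w⟩ := t
  simp only [r12, r23, affineMap, smul_add, smul_sub, hc, Prod.mk.injEq]
  refine ⟨trivial, ?_, ?_⟩
  · abel
  · abel_nf

theorem affineMap_bijective (L N : Aut V) (c : V) : Function.Bijective (affineMap L N c) := by
  refine Function.bijective_iff_has_inverse.2
    ⟨fun t => (t.1 + N⁻¹ • (t.2 - L⁻¹ • (t.1 - c)), L⁻¹ • (t.1 - c)), ?_, ?_⟩ <;>
  · rintro ⟨v, w⟩
    simp [affineMap]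

theorem smul_add_const_bijective (L : Aut V) (c : V) :
    Function.Bijective fun w : V => L • w + c :=
  (Equiv.addRight c).bijective.comp (MulAction.bijective L)

theorem affineMap_rho_bijective (L N : Aut V) (c w : V) :
    Function.Bijective fun v : V => w + N • (v - (L • w + c)) :=
  (Equiv.addLeft w).bijective.comp ((MulAction.bijective N).comp (Equiv.subRight _).bijective)

/-- A permutation of a finite set that preserves a partition induces a permutation of its
blocks. -/
theorem eq_of_apply_eq_of_preserves {V : Type*} {Y : Type*} [Finite V] {T : V → V}
    (hT : Function.Bijective T) {g : V → Y} (h : ∀ a b, g a = g b → g (T a) = g (T b)) (a b : V)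
    (hab : g (T a) = g (T b)) :
    g a = g b := by
  let e : Equiv.Perm V := Equiv.ofBijective T hT
  have hpow (m : ℕ) : g ((e ^ m) (e a)) = g ((e ^ m) (e b)) := by
    induction m with
    | zero => exact hab
    | succ m ih =>
      rw [pow_succ', Equiv.Perm.mul_apply, Equiv.Perm.mul_apply]
      exact h _ _ ih
  have h1 : e ^ (orderOf e - 1) * e = 1 := by
    rw [← pow_succ, Nat.sub_add_cancel (orderOf_pos e), pow_orderOf_eq_one]
  have := hpow (orderOf e - 1)
  rwa [← Equiv.Perm.mul_apply, ← Equiv.Perm.mul_apply, h1] at this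

/-- A morphism from the affine solution is constant or injective: its fibres are the cosets of a
subgroup stable under `L` and `A`. -/
theorem affineMap_constant_or_injective [Finite V] {A L N : Aut V}
    (hs : IsSimpleModule (genRing A L) V)
    (hNL : L * N = A⁻¹) (hA : Function.Bijective fun v : V => v - A⁻¹ • v)
    (c : V) {Y : Type*} (s : Y × Y → Y × Y) (g : V → Y)
    (hg : ∀ v w, s (g v, g w) = (g (affineMap L N c (v, w)).1, g (affineMap L N c (v, w)).2)) :
    (∀ v w, g v = g w) ∨ Function.Injective g := by
  have hL {a b : V} (hab : g a = g b) : g (L • a + c) = g (L • b + c) := by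
    have h1 := (hg 0 a).symm
    rw [hab, hg 0 b] at h1
    exact (Prod.ext_iff.1 h1).1
  -- The quandle operation of the derived solution also descends along `g`.
  have hq {v v' y : V} (hv : g v = g v') :
      g (y + A⁻¹ • (v - y)) = g (y + A⁻¹ • (v' - y)) := by
    obtain ⟨w, rfl⟩ := (smul_add_const_bijective L c).2 y
    have h1 := hg v w
    rw [hv, hg v' w] at h1
    have h2 := hL (Prod.ext_iff.1 h1).2.symm
    simp only [affineMap] at h2
    have h3 (z : V) : L • N • z = A⁻¹ • z := by rw [smul_smul, hNL]
    simp only [smul_add, smul_sub, h3] at h2 ⊢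
    convert h2 using 2 <;> abel
  have hq0 {v v' : V} (hv : g v = g v') : g (A⁻¹ • v) = g (A⁻¹ • v') := by
    simpa using hq (y := 0) hv
  have hq0' {v v' : V} : g (A⁻¹ • v) = g (A⁻¹ • v') → g v = g v' :=
    eq_of_apply_eq_of_preserves (T := fun v => A⁻¹ • v) (g := g) (MulAction.bijective A⁻¹)
      (fun _ _ => hq0) v v'
  have htr (t : V) {v v' : V} (hv : g v = g v') : g (v + t) = g (v' + t) := by
    obtain ⟨y, rfl⟩ := hA.2 t
    change g (v + (y - A⁻¹ • y)) = g (v' + (y - A⁻¹ • y))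
    have h1 : g (A • v) = g (A • v') := hq0' (by simpa using hv)
    have h2 := hq (y := y) h1
    simp only [smul_sub, inv_smul_smul] at h2
    convert h2 using 2 <;> abel
  have htr' {v v' : V} : g v = g v' ↔ g (v - v') = g 0 := by
    constructor
    · intro h
      simpa [sub_eq_add_neg] using htr (-v') h
    · intro h
      simpa using htr v' h
  let U : AddSubgroup V :=
    { carrier := {v | g v = g 0}
      zero_mem' := rfl
      add_mem' := fun {a b} ha hb => by
        have := htr b ha
        rw [zero_add] at this
        exact this.trans hb
      neg_mem' := fun {a} ha => by
        have := htr (-a) ha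
        rw [zero_add, add_neg_cancel] at this
        exact this.symm }
  let S : Submodule (genRing A L) V := submoduleOfStable U
    (fun v (hv : g v = g 0) => hq0' (by simpa using hv))
    (fun v (hv : g v = g 0) => by
      have h1 := htr (-c) (hL hv)
      change g (L • v) = g 0
      simpa using h1)
  have hmem {v : V} : v ∈ S ↔ g v = g 0 := Iff.rfl
  rcases eq_bot_or_eq_top S with hS | hS
  · right
    intro v w hvw
    have : v - w ∈ S := hmem.2 (htr'.1 hvw)
    rw [hS, Submodule.mem_bot] at this
    exact sub_eq_zero.1 this
  · left
    intro v w
    have (v : V) : g v = g 0 := hmem.1 (hS ▸ Submodule.mem_top)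
    rw [this v, this w]

end Affine

namespace Datum

variable {V : Type u} [AddCommGroup V] {p n k : ℕ} (D : Datum V p n k)

include D in
theorem finite : Finite V :=
  Nat.finite_of_card_ne_zero (by rw [D.card_eq]; exact pow_ne_zero _ D.prime.ne_zero)

include D in
theorem nontrivial : Nontrivial V :=
  have := D.simple
  IsSimpleModule.nontrivial (genRing D.A D.A') V

theorem A'_pow_k : D.A' ^ k = 1 :=
  orderOf_dvd_iff_pow_eq_one.mp (D.order_A'.trans (Nat.gcd_dvd_left _ _))

theorem pow_smul_comm (i : ℕ) (v : V) : D.A' • D.A ^ i • v = D.A ^ i • D.A' • v := by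
  have h : Commute D.A' (D.A ^ i) := (show Commute D.A' D.A from D.comm.symm).pow_right i
  rw [smul_smul, smul_smul, h.eq]

theorem sub_smul_bijective : Function.Bijective fun v : V => v - D.A • v :=
  one_sub_bijective D.simple D.comm D.A coe_mem_genRing D.A_ne_one

theorem sub_inv_smul_bijective : Function.Bijective fun v : V => v - D.A⁻¹ • v := by
  have h := (MulAction.bijective D.A⁻¹).comp ((Equiv.neg V).bijective.comp D.sub_smul_bijective)
  convert h using 2 with v
  simp [smul_sub]

/-! ### The skew left brace -/

theorem natCast_deg (a : D.Carrier) : ((a.deg : ℕ) : ZMod k) = a.idx := by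
  have : NeZero k := ⟨by have := D.one_lt_k; omega⟩
  exact ZMod.natCast_zmod_val _

theorem lambda_eq (a : D.Carrier) :
    D.lambda a = ⟨D.A' • a.vec + D.u₀ - D.A ^ a.deg • D.u₀, a.idx⟩ := by
  rw [lambda, nsmul_x]
  ext
  · simp [inV, Carrier.add_def]
  · simp [inV, Carrier.add_def, natCast_deg]

@[simp]
theorem lambda_idx (a : D.Carrier) : (D.lambda a).idx = a.idx := by rw [lambda_eq]

theorem lambda_add (a b : D.Carrier) : D.lambda (a + b) = D.lambda a + D.lambda b := by
  simp only [lambda_eq, Carrier.add_def, Carrier.deg, A_pow_val_add, smul_add, smul_sub,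
    pow_smul_comm, Carrier.mk.injEq, and_true]
  abel

theorem iterate_lambda_idx (m : ℕ) (a : D.Carrier) : (D.lambda^[m] a).idx = a.idx := by
  induction m with
  | zero => rfl
  | succ m ih => rw [Function.iterate_succ_apply', lambda_idx, ih]

theorem iterate_lambda_add (m : ℕ) (a b : D.Carrier) :
    D.lambda^[m] (a + b) = D.lambda^[m] a + D.lambda^[m] b := by
  induction m with
  | zero => rfl
  | succ m ih => simp only [Function.iterate_succ_apply', ih, lambda_add]

theorem iterate_lambda_vec (m : ℕ) (a : D.Carrier) :
    (D.lambda^[m] a).vec = D.A' ^ m • a.vec +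
      ∑ j ∈ Finset.range m, D.A' ^ j • (D.u₀ - D.A ^ a.deg • D.u₀) := by
  induction m with
  | zero => simp
  | succ m ih =>
    rw [Function.iterate_succ_apply', lambda_eq, Finset.sum_range_succ']
    have hdeg : (D.lambda^[m] a).deg = a.deg := congrArg ZMod.val (D.iterate_lambda_idx m a)
    simp only [ih, hdeg, smul_add, Finset.smul_sum, smul_smul, ← pow_succ', pow_zero, one_smul]
    abel

theorem iterate_lambda_k (a : D.Carrier) : D.lambda^[k] a = a := by
  ext
  · rw [iterate_lambda_vec, A'_pow_k, one_smul, add_eq_left]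
    by_cases hA' : D.A' = 1
    · simp only [hA', one_pow, one_smul, Finset.sum_const, Finset.card_range]
      by_cases hv : D.u₀ - D.A • D.u₀ = 0
      · have hfix : D.A • D.u₀ = D.u₀ := (sub_eq_zero.1 hv).symm
        have (i : ℕ) : D.A ^ i • D.u₀ = D.u₀ := by
          induction i with
          | zero => simp
          | succ i ih => rw [pow_succ, mul_smul, hfix, ih]
        rw [this, sub_self, smul_zero]
      · have hk (v : V) : k • v = (orderOf D.A * p) • v := congrArg (· • v) (D.k_eq₂ hA' hv)
        rw [hk, mul_smul, D.elementary, smul_zero]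
    · exact sum_pow_smul_eq_zero D.simple D.comm hA' D.A'_pow_k _
  · exact D.iterate_lambda_idx k a

theorem iterate_lambda_mod (m : ℕ) (a : D.Carrier) : D.lambda^[m % k] a = D.lambda^[m] a := by
  have h : D.lambda^[k] = id := funext D.iterate_lambda_k
  conv_rhs => rw [← Nat.mod_add_div m k, Function.iterate_add_apply, Function.iterate_mul, h,
    Function.iterate_id, id_eq]

theorem iterate_lambda_val_add (i j : ZMod k) (a : D.Carrier) :
    D.lambda^[(i + j).val] a = D.lambda^[i.val] (D.lambda^[j.val] a) := by
  have : NeZero k := ⟨by have := D.one_lt_k; omega⟩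
  rw [ZMod.val_add, iterate_lambda_mod, Function.iterate_add_apply]

theorem circ_idx (a b : D.Carrier) : (D.circ a b).idx = a.idx + b.idx := by
  simp [circ, Carrier.add_def, iterate_lambda_idx]

/-- The multiplicative group `(B, ∘)`. As `a ↦ λ^|a|` is a homomorphism to `Aut (B, +)` and `λ`
preserves `|·|`, the operation `∘` is a group law. -/
@[reducible]
def circGroup : Group D.Carrier :=
  letI : Mul D.Carrier := ⟨D.circ⟩
  letI : One D.Carrier := ⟨0⟩
  letI : Inv D.Carrier := ⟨fun a => -D.lambda^[(-a.idx).val] a⟩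
  Group.ofLeftAxioms
    (fun a b c => by
      change D.circ (D.circ a b) c = D.circ a (D.circ b c)
      have h := D.circ_idx a b
      rw [circ, Carrier.deg, h, iterate_lambda_val_add, circ, circ, circ, iterate_lambda_add,
        add_assoc]
      rfl)
    (fun a => by
      change D.circ 0 a = a
      rw [circ, zero_add, Carrier.deg, Carrier.zero_def, ZMod.val_zero, Function.iterate_zero,
        id_eq])
    (fun a => by
      change D.circ (-D.lambda^[(-a.idx).val] a) a = 0
      have h : (-D.lambda^[(-a.idx).val] a).idx = -a.idx := by
        rw [Carrier.neg_def]
        simp only [iterate_lambda_idx]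
      rw [circ, Carrier.deg, h, neg_add_cancel])

/-- The skew left brace `(B, +, ∘)` on `V ⋊ C`. -/
@[reducible]
def skewLeftBrace : SkewLeftBrace D.Carrier :=
  { D.circGroup with
    mul_add_eq := fun a b c => by
      change D.circ a (b + c) = D.circ a b - a + D.circ a c
      simp only [circ, iterate_lambda_add, add_assoc, sub_eq_add_neg, neg_add_cancel_left] }

attribute [local instance] skewLeftBrace

theorem mul_eq_circ (a b : D.Carrier) : a * b = D.circ a b := rfl

theorem lam_eq (a b : D.Carrier) : lam a b = D.lambda^[a.deg] b := by
  rw [lam, mul_eq_circ, circ, neg_add_cancel_left]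

theorem deg_x : D.x.deg = 1 := by
  have : Fact (1 < k) := ⟨D.one_lt_k⟩
  exact ZMod.val_one k

theorem inV_add_x (v : V) : D.inV v + D.x = ⟨v, 1⟩ := by
  ext
  · simp [inV, x, Carrier.add_def]
  · simp [inV, x, Carrier.add_def]

theorem lambda_mk_one (v : V) : D.lambda ⟨v, 1⟩ = ⟨D.A' • v + D.v₁, 1⟩ := by
  have : (⟨v, 1⟩ : D.Carrier).deg = 1 := D.deg_x
  rw [lambda_eq, this, v₁, pow_one, add_sub_assoc]

theorem lambda_inV (v : V) : D.lambda (D.inV v) = D.inV (D.A' • v) := by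
  rw [lambda_eq]
  simp [inV, Carrier.deg]

theorem mk_one_add (v w : V) (i : ZMod k) :
    (⟨v, 1⟩ + ⟨w, i⟩ : D.Carrier) = ⟨v + D.A • w, 1 + i⟩ := by
  have h : (1 : ZMod k).val = 1 := D.deg_x
  rw [Carrier.add_def]
  simp only [h, pow_one]

theorem rB_mk_one (v w : V) : rB ((⟨v, 1⟩ : D.Carrier), (⟨w, 1⟩ : D.Carrier)) =
    (⟨(affineMap D.A' (D.A * D.A')⁻¹ D.v₁ (v, w)).1, 1⟩,
      ⟨(affineMap D.A' (D.A * D.A')⁻¹ D.v₁ (v, w)).2, 1⟩) := by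
  have hdeg (v : V) : (⟨v, 1⟩ : D.Carrier).deg = 1 := D.deg_x
  have h1 : lam (⟨v, 1⟩ : D.Carrier) ⟨w, 1⟩ = ⟨D.A' • w + D.v₁, 1⟩ := by
    rw [lam_eq, hdeg, Function.iterate_one, lambda_mk_one]
  simp only [rB, h1, affineMap, Prod.mk.injEq, true_and]
  rw [mul_assoc, inv_mul_eq_iff_eq_mul, mul_eq_circ, mul_eq_circ, circ, circ, hdeg, hdeg,
    Function.iterate_one, lambda_mk_one, lambda_mk_one, mk_one_add, mk_one_add]
  have h2 (z : V) : D.A • D.A' • (D.A * D.A')⁻¹ • z = z := by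
    rw [smul_smul D.A, smul_inv_smul]
  simp only [smul_add, smul_sub, h2, Carrier.mk.injEq, and_true]
  abel

/-! ### The solution on `X` -/

theorem add_x_sub (g : D.Carrier) : g + D.x - g = ⟨g.vec - D.A • g.vec, 1⟩ := by
  rw [sub_eq_iff_eq_add, mk_one_add]
  ext
  · simp [x, Carrier.add_def]
  · simp [x, Carrier.add_def, add_comm]

theorem mem_X_iff {a : D.Carrier} : a ∈ D.X ↔ a.idx = 1 := by
  simp only [X, add_x_sub, Set.mem_ofPred_eq]
  constructor
  · rintro ⟨v, rfl⟩
    rfl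
  · intro ha
    obtain ⟨v, hv⟩ := D.sub_smul_bijective.2 a.vec
    exact ⟨v, Carrier.ext hv.symm ha⟩

theorem X_eq_conj : D.X = {a | ∃ g : D.Carrier, a = g + D.x - g} := by
  ext a
  constructor
  · rintro ⟨v, hv⟩
    exact ⟨_, hv⟩
  · rintro ⟨g, rfl⟩
    rw [mem_X_iff, add_x_sub]

theorem X_eq_inV_add : D.X = {a | ∃ v : V, a = D.inV v + D.x} := by
  ext a
  simp only [mem_X_iff, inV_add_x, Set.mem_ofPred_eq]
  constructor
  · intro h
    exact ⟨a.vec, Carrier.ext rfl h⟩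
  · rintro ⟨v, rfl⟩
    rfl

/-- The bijection `v ↦ v + x` from `V` to `X`. -/
def equivX : V ≃ D.X where
  toFun v := ⟨⟨v, 1⟩, D.mem_X_iff.2 rfl⟩
  invFun a := a.1.vec
  left_inv _ := rfl
  right_inv a := Subtype.ext (Carrier.ext rfl (D.mem_X_iff.1 a.2).symm)

theorem X_finite : D.X.Finite :=
  have := D.finite
  have := Finite.of_equiv V D.equivX
  Set.toFinite _

theorem restrictsTo_X : RestrictsTo rB D.X := by
  intro a ha b hb
  obtain ⟨v, hv⟩ := D.equivX.surjective ⟨a, ha⟩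
  obtain ⟨w, hw⟩ := D.equivX.surjective ⟨b, hb⟩
  obtain rfl : ⟨v, 1⟩ = a := congrArg Subtype.val hv
  obtain rfl : ⟨w, 1⟩ = b := congrArg Subtype.val hw
  rw [rB_mk_one, mem_X_iff, mem_X_iff]
  exact ⟨rfl, rfl⟩

theorem restr_equivX (v w : V) : restr rB D.restrictsTo_X (D.equivX v, D.equivX w) =
    (D.equivX (affineMap D.A' (D.A * D.A')⁻¹ D.v₁ (v, w)).1,
      D.equivX (affineMap D.A' (D.A * D.A')⁻¹ D.v₁ (v, w)).2) := by
  have h := D.rB_mk_one v w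
  exact Prod.ext (Subtype.ext (congrArg Prod.fst h)) (Subtype.ext (congrArg Prod.snd h))

theorem A'_comm_inv : D.A' * (D.A * D.A')⁻¹ = (D.A * D.A')⁻¹ * D.A' := by
  have h : Commute D.A' (D.A * D.A') :=
    (show Commute D.A' D.A from D.comm.symm).mul_right (Commute.refl _)
  exact h.inv_right.eq

theorem A'_mul_inv : D.A' * (D.A * D.A')⁻¹ = D.A⁻¹ := by
  rw [mul_inv_rev, mul_inv_cancel_left]

theorem isNondegSolution : IsNondegSolution (restr rB D.restrictsTo_X) where
  nonempty := ⟨D.equivX 0⟩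
  braid := by
    rintro ⟨a, b, c⟩
    obtain ⟨u, rfl⟩ := D.equivX.surjective a
    obtain ⟨v, rfl⟩ := D.equivX.surjective b
    obtain ⟨w, rfl⟩ := D.equivX.surjective c
    have h := affineMap_braid D.A'_comm_inv D.v₁ (u, v, w)
    have h' := congrArg (Prod.map D.equivX (Prod.map D.equivX D.equivX)) h
    simp only [r12, r23, Prod.map] at h'
    simpa only [r12, r23, restr_equivX] using h'
  bijective := by
    let e := D.equivX.prodCongr D.equivX
    have h := e.bijective.comp ((affineMap_bijective D.A' (D.A * D.A')⁻¹ D.v₁).comp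
      e.symm.bijective)
    convert h using 1
    ext1 t
    obtain ⟨⟨v, w⟩, rfl⟩ := e.surjective t
    rw [Function.comp_apply, Function.comp_apply, e.symm_apply_apply]
    exact D.restr_equivX v w
  lam_bijective := by
    intro a
    obtain ⟨v, rfl⟩ := D.equivX.surjective a
    have h := D.equivX.bijective.comp ((smul_add_const_bijective D.A' D.v₁).comp
      D.equivX.symm.bijective)
    convert h using 1
    ext1 b
    obtain ⟨w, rfl⟩ := D.equivX.surjective b
    simp [lamMap, restr_equivX, affineMap]
  rho_bijective := by
    intro b
    obtain ⟨w, rfl⟩ := D.equivX.surjective b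
    have h := D.equivX.bijective.comp
      ((affineMap_rho_bijective D.A' (D.A * D.A')⁻¹ D.v₁ w).comp D.equivX.symm.bijective)
    convert h using 1
    ext1 a
    obtain ⟨v, rfl⟩ := D.equivX.surjective a
    simp [rhoMap, restr_equivX, affineMap]

theorem sigmaMap_equivX (y v : V) : sigmaMap D.isNondegSolution (D.equivX y) (D.equivX v) =
    D.equivX (y + D.A⁻¹ • (v - y)) := by
  obtain ⟨w, rfl⟩ := (smul_add_const_bijective D.A' D.v₁).2 y
  have h : (Equiv.ofBijective _ (D.isNondegSolution.lam_bijective (D.equivX v))).symm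
      (D.equivX (D.A' • w + D.v₁)) = D.equivX w := by
    rw [Equiv.symm_apply_eq]
    simp [lamMap, restr_equivX, affineMap]
  have h3 (z : V) : D.A' • (D.A * D.A')⁻¹ • z = D.A⁻¹ • z := by rw [smul_smul, A'_mul_inv]
  simp only [sigmaMap, h, lamMap, rhoMap, restr_equivX, affineMap, smul_add, h3]
  congr 1
  abel

theorem isIrretractable : IsIrretractable D.isNondegSolution := by
  intro a b hab
  obtain ⟨y, rfl⟩ := D.equivX.surjective a
  obtain ⟨z, rfl⟩ := D.equivX.surjective b
  have h := congrFun (Prod.ext_iff.1 hab).1 (D.equivX 0)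
  simp only [sigmaMap_equivX] at h
  have h' := D.equivX.injective h
  congr 1
  apply D.sub_inv_smul_bijective.1
  simpa [sub_eq_add_neg] using h'

theorem isSimpleSolution : IsSimpleSolution (restr rB D.restrictsTo_X) where
  toIsSolution := D.isNondegSolution.toIsSolution
  nontrivial := have := D.nontrivial; D.equivX.symm.nontrivial
  image := by
    intro Y s f _ hf hsurj
    have := D.finite
    have hinv : Function.Bijective fun v : V => v - D.A⁻¹ • v := D.sub_inv_smul_bijective
    rcases affineMap_constant_or_injective D.simple D.A'_mul_inv hinv D.v₁ s (f ∘ D.equivX)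
      (fun v w => by
        have := hf (D.equivX v) (D.equivX w)
        rw [restr_equivX] at this
        exact this) with h | h
    · left
      refine ⟨fun a b => ?_⟩
      obtain ⟨a, rfl⟩ := (hsurj.comp D.equivX.surjective) a
      obtain ⟨b, rfl⟩ := (hsurj.comp D.equivX.surjective) b
      exact h a b
    · right
      refine ⟨Equiv.ofBijective f ⟨?_, hsurj⟩, hf⟩
      exact (Function.Injective.of_comp_iff' f D.equivX.bijective).1 h

theorem rB_inV_add_x (v w : V) : rB (D.inV v + D.x, D.inV w + D.x) =
    (D.inV (D.A' • w + D.v₁) + D.x,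
      D.inV (-(D.A⁻¹ • w) + (D.A * D.A')⁻¹ • (v - D.v₁) + w) + D.x) := by
  have h3 (z : V) : (D.A * D.A')⁻¹ • D.A' • z = D.A⁻¹ • z := by
    rw [smul_smul, ← A'_comm_inv, A'_mul_inv]
  simp only [inV_add_x, rB_mk_one, affineMap, smul_sub, smul_add, h3, Prod.mk.injEq,
    Carrier.mk.injEq, and_true, true_and]
  abel

end Datum

/-! ### Ideals of skew left braces -/

section Brace

variable {B : Type u} [AddGroup B] [SkewLeftBrace B]

theorem mul_zero_eq (a : B) : a * (0 : B) = a := by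
  have h := SkewLeftBrace.mul_add_eq a (0 : B) 0
  rw [add_zero, sub_eq_add_neg, add_assoc, left_eq_add, neg_add_eq_zero] at h
  exact h.symm

theorem one_eq_zero : (1 : B) = 0 := by rw [← mul_zero_eq (1 : B), one_mul]

theorem mul_eq_add_lam (a b : B) : a * b = a + lam a b := by rw [lam, add_neg_cancel_left]

theorem lam_add (a b c : B) : lam a (b + c) = lam a b + lam a c := by
  simp only [lam, SkewLeftBrace.mul_add_eq, sub_eq_add_neg, add_assoc]

theorem lam_mul (a b c : B) : lam (a * b) c = lam a (lam b c) := by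
  have h : a * b + lam (a * b) c = a * b + lam a (lam b c) := by
    rw [← mul_eq_add_lam, mul_assoc, mul_eq_add_lam b c, mul_eq_add_lam a (b + lam b c), lam_add,
      ← add_assoc, ← mul_eq_add_lam]
  exact add_left_cancel h

theorem lam_zero_left (b : B) : lam 0 b = b := by
  rw [lam, neg_zero, zero_add, ← one_eq_zero, one_mul]

/-- The automorphism `λ_a` of `(B, +)`. -/
def lamHom (a : B) : B →+ B := AddMonoidHom.mk' (lam a) (lam_add a)

theorem lam_neg (a b : B) : lam a (-b) = -lam a b := (lamHom a).map_neg b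

theorem lam_zero (a : B) : lam a 0 = 0 := (lamHom a).map_zero

theorem lam_sub (a b c : B) : lam a (b - c) = lam a b - lam a c := (lamHom a).map_sub b c

theorem lam_nsmul (a : B) (m : ℕ) (b : B) : lam a (m • b) = m • lam a b :=
  (lamHom a).map_nsmul m b

theorem lam_lam_inv (a b : B) : lam a (lam a⁻¹ b) = b := by
  rw [← lam_mul, mul_inv_cancel, one_eq_zero, lam_zero_left]

theorem star_eq (a b : B) : star a b = lam a b - b := rfl

theorem add_lam_inv (a : B) : a + lam a a⁻¹ = 0 := by
  rw [← mul_eq_add_lam, mul_inv_cancel, one_eq_zero]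

/-- Normality in `(B, ∘)` follows from the conjugation formula
`c ∘ v ∘ c⁻¹ = (c + λ_c(v) - c) + (c + λ_c(v * c⁻¹) - c)`. -/
theorem IsIdeal.of_lam_mem {I : AddSubgroup B} (hn : I.Normal)
    (hl : ∀ a, ∀ v ∈ I, lam a v ∈ I) (hs : ∀ v ∈ I, ∀ b, star v b ∈ I) : IsIdeal I where
  normal := hn
  lam_mem a := by
    refine Set.Subset.antisymm ?_ fun v hv => ⟨lam a⁻¹ v, hl _ _ hv, lam_lam_inv a v⟩
    rintro _ ⟨v, hv, rfl⟩
    exact hl a v hv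
  mul_normal := by
    refine ⟨{ carrier := I, mul_mem' := ?_, one_mem' := ?_, inv_mem' := ?_ }, ⟨?_⟩, rfl⟩
    · intro a b ha hb
      rw [mul_eq_add_lam]
      exact I.add_mem ha (hl a b hb)
    · rw [one_eq_zero]
      exact I.zero_mem
    · intro a ha
      have h := add_lam_inv a⁻¹
      rw [inv_inv] at h
      rw [eq_neg_of_add_eq_zero_left h]
      exact I.neg_mem (hl _ a ha)
    · intro v hv c
      have h : c * v * c⁻¹ = (c + lam c v - c) + (c + lam c (star v c⁻¹) - c) := by
        have h1 : lam c c⁻¹ = -c := (neg_eq_of_add_eq_zero_right (add_lam_inv c)).symm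
        rw [mul_eq_add_lam (c * v), lam_mul, mul_eq_add_lam c v, star_eq, lam_sub, h1]
        simp [sub_eq_add_neg, add_assoc]
      change c * v * c⁻¹ ∈ I
      rw [h, sub_eq_add_neg, sub_eq_add_neg]
      exact I.add_mem (hn.conj_mem _ (hl c v hv) c) (hn.conj_mem _ (hl c _ (hs v hv _)) c)

theorem lam_star (c a b : B) : lam c (star a b) = star (c * a * c⁻¹) (lam c b) := by
  rw [star_eq, star_eq, lam_sub, ← lam_mul, ← lam_mul, inv_mul_cancel_right]

theorem conj_star (a b c : B) : b + star a c - b = -star a b + star a (b + c) := by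
  simp only [star_eq, lam_add, sub_eq_add_neg, neg_add_rev, add_assoc, neg_neg,
    neg_add_cancel_left]

theorem isIdeal_B2 : IsIdeal (B2 B) := by
  refine IsIdeal.of_lam_mem ⟨fun v hv g => ?_⟩ (fun a v hv => ?_)
    (fun v _ b => AddSubgroup.subset_closure ⟨v, b, rfl⟩)
  · induction hv using AddSubgroup.closure_induction with
    | mem v hv =>
      obtain ⟨a, c, rfl⟩ := hv
      rw [← sub_eq_add_neg, conj_star]
      exact (B2 B).add_mem ((B2 B).neg_mem (AddSubgroup.subset_closure ⟨_, _, rfl⟩))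
        (AddSubgroup.subset_closure ⟨_, _, rfl⟩)
    | zero => simp [(B2 B).zero_mem]
    | add v w _ _ hv hw => simpa [add_assoc] using (B2 B).add_mem hv hw
    | neg v _ hv => simpa [add_assoc] using (B2 B).neg_mem hv
  · induction hv using AddSubgroup.closure_induction with
    | mem v hv =>
      obtain ⟨b, c, rfl⟩ := hv
      rw [lam_star]
      exact AddSubgroup.subset_closure ⟨_, _, rfl⟩
    | zero => rw [lam_zero]; exact (B2 B).zero_mem
    | add v w _ _ hv hw => rw [lam_add]; exact (B2 B).add_mem hv hw
    | neg v _ hv => rw [lam_neg]; exact (B2 B).neg_mem hv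

/-- If `B⁽³⁾ = 0` then the smallest ideal acts trivially: either `B⁽²⁾ = 0`, or `B⁽²⁾` contains
it. -/
theorem IsSmallestIdeal.lam_eq {V : AddSubgroup B} (hV : IsSmallestIdeal V) (h3 : B3 B = ⊥)
    {v : B} (hv : v ∈ V) (b : B) : lam v b = b := by
  rw [← sub_eq_zero, ← star_eq, ← AddSubgroup.mem_bot]
  by_cases h2 : B2 B = ⊥
  · rw [← h2]
    exact AddSubgroup.subset_closure ⟨v, b, rfl⟩
  · rw [← h3]
    exact AddSubgroup.subset_closure ⟨v, hV.le _ isIdeal_B2 h2 hv, b, rfl⟩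

/-- If an ideal `V` acts trivially and `B / V` is trivial, then `λ` is multiplicative for `+`. -/
theorem lam_add_left {V : AddSubgroup B} (hn : V.Normal) (hl : ∀ v ∈ V, ∀ b, lam v b = b)
    (hq : ∀ a b : B, ((a * b : B) : B ⧸ V) = ((a + b : B) : B ⧸ V)) (a b c : B) :
    lam (a + b) c = lam a (lam b c) := by
  have hv : a + b - a * b ∈ V := by
    rw [sub_eq_add_neg]
    exact hn.mem_comm (QuotientAddGroup.eq.1 (hq a b))
  have h : a + b = (a + b - a * b) * (a * b) := by
    rw [mul_eq_add_lam (a + b - a * b), hl _ hv, sub_add_cancel]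
  rw [h, lam_mul, hl _ hv, lam_mul]

end Brace

/-! ### Skew left braces in linear coordinates -/

/-- A skew left brace in linear coordinates: an abelian group `W` embedded in `(B, +)` by `ι`, with
`λ_w = 1` for `w ∈ W`, and an element `x₀` that together with `W` generates `(B, +)`. Conjugation by
`x₀` and `λ_{x₀}` act on `W` as `A ≠ 1` and `A'`, while `λ_{x₀}(x₀) = v₁ + x₀`; moreover `λ` is a
homomorphism on `(B, +)` and every non-zero ideal contains `W`. -/
structure LinearBrace (B : Type u) [AddGroup B] [SkewLeftBrace B] (W : Type u)
    [AddCommGroup W] where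
  ι : W →+ B
  x₀ : B
  A : Aut W
  A' : Aut W
  v₁ : W
  ι_injective : Function.Injective ι
  ι_A : ∀ w, ι (A • w) = x₀ + ι w - x₀
  ι_A' : ∀ w, ι (A' • w) = lam x₀ (ι w)
  lam_ι : ∀ w b, lam (ι w) b = b
  lam_add_left : ∀ a b c : B, lam (a + b) c = lam a (lam b c)
  lam_x₀ : lam x₀ x₀ = ι v₁ + x₀
  exists_eq : ∀ b : B, ∃ w, ∃ m : ℕ, b = ι w + m • x₀
  minimal : ∀ I : AddSubgroup B, IsIdeal I → I ≠ ⊥ → ∀ w, ι w ∈ I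
  A_ne_one : A ≠ 1

namespace LinearBrace

variable {B : Type u} [AddGroup B] [SkewLeftBrace B] {W : Type u} [AddCommGroup W]
  (E : LinearBrace B W)

theorem x₀_add_ι (w : W) : E.x₀ + E.ι w = E.ι (E.A • w) + E.x₀ := by
  rw [E.ι_A, sub_add_cancel]

theorem nsmul_add_ι (m : ℕ) (w : W) : m • E.x₀ + E.ι w = E.ι (E.A ^ m • w) + m • E.x₀ := by
  induction m with
  | zero => simp
  | succ m ih =>
    rw [succ_nsmul', add_assoc, ih, ← add_assoc, x₀_add_ι, smul_smul, ← pow_succ', add_assoc]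

theorem lam_nsmul_x₀ (m : ℕ) (b : B) : lam (m • E.x₀) b = (lam E.x₀)^[m] b := by
  induction m with
  | zero => rw [zero_nsmul, lam_zero_left, Function.iterate_zero, id_eq]
  | succ m ih => rw [succ_nsmul', E.lam_add_left, ih, Function.iterate_succ_apply']

theorem iterate_lam_ι (m : ℕ) (w : W) : (lam E.x₀)^[m] (E.ι w) = E.ι (E.A' ^ m • w) := by
  induction m with
  | zero => simp
  | succ m ih => rw [Function.iterate_succ_apply', ih, ← E.ι_A', smul_smul, ← pow_succ']

theorem iterate_lam_x₀ (m : ℕ) :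
    (lam E.x₀)^[m] E.x₀ = E.ι (∑ j ∈ Finset.range m, E.A' ^ j • E.v₁) + E.x₀ := by
  induction m with
  | zero => simp
  | succ m ih =>
    rw [Function.iterate_succ_apply', ih, lam_add, ← E.ι_A', E.lam_x₀, ← add_assoc, ← map_add,
      Finset.sum_range_succ', Finset.smul_sum]
    simp only [smul_smul, ← pow_succ', pow_zero, one_smul]

theorem comm : E.A * E.A' = E.A' * E.A := by
  refine Units.ext (AddMonoidHom.ext fun w => E.ι_injective ?_)
  change E.ι (E.A • E.A' • w) = E.ι (E.A' • E.A • w)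
  rw [E.ι_A', E.ι_A w, lam_sub, lam_add, E.lam_x₀, ← E.ι_A', add_assoc, x₀_add_ι, ← add_assoc,
    ← map_add, add_comm E.v₁, map_add, add_assoc, add_sub_cancel_right]

/-- A subgroup of `W` stable under `A` and `A'` is an ideal of `B`. -/
theorem isIdeal_map {U : AddSubgroup W} (hA : ∀ w ∈ U, E.A • w ∈ U)
    (hA' : ∀ w ∈ U, E.A' • w ∈ U) : IsIdeal (U.map E.ι) := by
  have hp (C : Aut W) (hC : ∀ w ∈ U, C • w ∈ U) (m : ℕ) (w : W) (hw : w ∈ U) : C ^ m • w ∈ U := by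
    induction m with
    | zero => simpa using hw
    | succ m ih => rw [pow_succ', mul_smul]; exact hC _ ih
  refine IsIdeal.of_lam_mem ⟨?_⟩ ?_ ?_
  · rintro _ ⟨u, hu, rfl⟩ b
    obtain ⟨w, m, rfl⟩ := E.exists_eq b
    refine ⟨E.A ^ m • u, hp _ hA m u hu, ?_⟩
    rw [eq_add_neg_iff_add_eq, add_assoc, nsmul_add_ι, ← add_assoc, ← add_assoc, ← map_add,
      ← map_add, add_comm]
  · rintro b _ ⟨u, hu, rfl⟩
    obtain ⟨w, m, rfl⟩ := E.exists_eq b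
    refine ⟨E.A' ^ m • u, hp _ hA' m u hu, ?_⟩
    rw [E.lam_add_left, E.lam_ι, lam_nsmul_x₀, iterate_lam_ι]
  · rintro _ ⟨u, _, rfl⟩ b
    rw [star_eq, E.lam_ι, sub_self]
    exact AddSubgroup.zero_mem _

theorem eq_top_of_stable {U : AddSubgroup W} (hA : ∀ w ∈ U, E.A • w ∈ U)
    (hA' : ∀ w ∈ U, E.A' • w ∈ U) (hU : U ≠ ⊥) (w : W) : w ∈ U := by
  have h := E.minimal _ (E.isIdeal_map hA hA')
    (fun h0 => hU ((AddSubgroup.map_eq_bot_iff_of_injective _ E.ι_injective).1 h0)) w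
  obtain ⟨u, hu, huw⟩ := h
  exact E.ι_injective huw ▸ hu

theorem isSimpleModule [Nontrivial W] : IsSimpleModule (genRing E.A E.A') W := by
  rw [isSimpleModule_iff]
  refine { eq_bot_or_eq_top := fun S => or_iff_not_imp_left.2 fun hS => ?_ }
  have hmem (w : W) : w ∈ S.toAddSubgroup := by
    refine E.eq_top_of_stable
      (fun w hw => S.smul_mem (⟨E.A, coe_mem_genRing⟩ : genRing E.A E.A') hw)
      (fun w hw => S.smul_mem (⟨E.A', coe_mem_genRing'⟩ : genRing E.A E.A') hw) ?_ w
    exact fun h0 =>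
      hS (Submodule.toAddSubgroup_injective (h0.trans Submodule.bot_toAddSubgroup.symm))
  exact eq_top_iff.2 fun w _ => hmem w

include E in
theorem exists_prime [Nontrivial W] [Finite W] :
    ∃ p n : ℕ, p.Prime ∧ 1 ≤ n ∧ Nat.card W = p ^ n ∧ ∀ w : W, p • w = 0 := by
  obtain ⟨p, hp, hpd⟩ := Nat.exists_prime_and_dvd (Finite.one_lt_card (α := W)).ne'
  have := Fact.mk hp
  obtain ⟨w₀, hw₀⟩ := exists_prime_addOrderOf_dvd_card' p hpd
  let U : AddSubgroup W := (nsmulAddMonoidHom p).ker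
  have hmem (w : W) : w ∈ U ↔ p • w = 0 := Iff.rfl
  have hC (C : Aut W) (w : W) (hw : w ∈ U) : C • w ∈ U := by
    rw [hmem] at hw ⊢
    rw [smul_comm, hw, smul_zero]
  have hU : U ≠ ⊥ := by
    intro h0
    have h1 : w₀ ∈ U := (hmem w₀).2 (hw₀ ▸ addOrderOf_nsmul_eq_zero w₀)
    rw [h0, AddSubgroup.mem_bot] at h1
    rw [h1, addOrderOf_zero] at hw₀
    exact hp.one_lt.ne hw₀
  have hel (w : W) : p • w = 0 := (hmem w).1 (E.eq_top_of_stable (hC _) (hC _) hU w)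
  let _ : Module (ZMod p) W := AddCommGroup.zmodModule hel
  have hcard := (FiniteField.pow_finrank_eq_natCard p W).symm
  refine ⟨p, _, hp, Nat.one_le_iff_ne_zero.2 fun h0 => ?_, hcard, hel⟩
  rw [h0, pow_zero] at hcard
  exact (Finite.one_lt_card (α := W)).ne' hcard

theorem A_pow_addOrderOf : E.A ^ addOrderOf E.x₀ = 1 := by
  refine Units.ext (AddMonoidHom.ext fun w => E.ι_injective ?_)
  have h := E.nsmul_add_ι (addOrderOf E.x₀) w
  rw [addOrderOf_nsmul_eq_zero, zero_add, add_zero] at h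
  exact h.symm

theorem A'_pow_addOrderOf : E.A' ^ addOrderOf E.x₀ = 1 := by
  refine Units.ext (AddMonoidHom.ext fun w => E.ι_injective ?_)
  have h := E.iterate_lam_ι (addOrderOf E.x₀) w
  rw [← lam_nsmul_x₀, addOrderOf_nsmul_eq_zero, lam_zero_left] at h
  exact h.symm

theorem sum_pow_addOrderOf : ∑ j ∈ Finset.range (addOrderOf E.x₀), E.A' ^ j • E.v₁ = 0 := by
  have h := E.iterate_lam_x₀ (addOrderOf E.x₀)
  rw [← lam_nsmul_x₀, addOrderOf_nsmul_eq_zero, lam_zero_left, right_eq_add] at h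
  exact E.ι_injective (h.trans (map_zero _).symm)

section

variable [Nontrivial W]

theorem sub_smul_bijective : Function.Bijective fun w : W => w - E.A • w :=
  one_sub_bijective E.isSimpleModule E.comm E.A coe_mem_genRing E.A_ne_one

/-- `W` meets the cyclic group generated by `x₀` trivially, as `A` has no fixed points. -/
theorem eq_zero_of_ι_eq_nsmul {w : W} {m : ℕ} (h : E.ι w = m • E.x₀) : w = 0 := by
  apply E.sub_smul_bijective.1
  have h1 : E.ι (E.A • w) = E.ι w := by
    rw [E.ι_A, h, ← succ_nsmul', succ_nsmul, add_sub_cancel_right]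
  simp [E.ι_injective h1]

/-- The hypotheses say that `m x₀` is central and that `λ_{m x₀} = 1`; it is also fixed by `λ`,
since `λ_{x₀}(x₀)` is conjugate to `x₀`. It thus spans an ideal, which meets `W` trivially. -/
theorem nsmul_x₀_eq_zero [Finite B] {m : ℕ} (hA : E.A ^ m = 1) (hA' : E.A' ^ m = 1)
    (hs : ∑ j ∈ Finset.range m, E.A' ^ j • E.v₁ = 0) : m • E.x₀ = 0 := by
  obtain ⟨u₀, hu₀⟩ := E.sub_smul_bijective.2 E.v₁
  have hcomm (j : ℕ) (b : B) : b + j • m • E.x₀ = j • m • E.x₀ + b := by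
    obtain ⟨w, i, rfl⟩ := E.exists_eq b
    have hj : E.A ^ (j * m) = 1 := by rw [mul_comm, pow_mul, hA, one_pow]
    have h1 := E.nsmul_add_ι (j * m) w
    rw [hj, one_smul] at h1
    rw [← mul_nsmul', ← add_assoc, h1, add_assoc, add_assoc, ← add_nsmul, ← add_nsmul, add_comm i]
  have hconj : lam E.x₀ E.x₀ = E.ι u₀ + E.x₀ - E.ι u₀ := by
    rw [E.lam_x₀, ← hu₀, eq_sub_iff_add_eq, add_assoc, x₀_add_ι, ← add_assoc, ← map_add,
      sub_add_cancel]
  have hlam (b : B) (j : ℕ) : lam b (j • m • E.x₀) = j • m • E.x₀ := by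
    have h1 : lam E.x₀ (j • m • E.x₀) = j • m • E.x₀ := by
      have h2 (i : ℕ) : i • (E.ι u₀ + E.x₀ - E.ι u₀) = E.ι u₀ + i • E.x₀ - E.ι u₀ := by
        induction i with
        | zero => simp
        | succ i ih => rw [succ_nsmul, ih, succ_nsmul]; simp [sub_eq_add_neg, add_assoc]
      rw [← mul_nsmul', lam_nsmul, hconj, h2, mul_nsmul', hcomm, add_sub_cancel_right]
    obtain ⟨w, i, rfl⟩ := E.exists_eq b
    rw [E.lam_add_left, E.lam_ι, lam_nsmul_x₀]
    exact Function.IsFixedPt.iterate h1 i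
  have hker (j : ℕ) (b : B) : lam (j • m • E.x₀) b = b := by
    have h1 (b : B) : lam (m • E.x₀) b = b := by
      have hx : lam (m • E.x₀) E.x₀ = E.x₀ := by
        rw [lam_nsmul_x₀, iterate_lam_x₀, hs, map_zero, zero_add]
      obtain ⟨w, i, rfl⟩ := E.exists_eq b
      rw [lam_add, lam_nsmul, hx, lam_nsmul_x₀, iterate_lam_ι, hA', one_smul]
    induction j with
    | zero => rw [zero_nsmul, lam_zero_left]
    | succ j ih => rw [succ_nsmul, E.lam_add_left, h1, ih]
  have hmem {z : B} (hz : z ∈ AddSubgroup.zmultiples (m • E.x₀)) : ∃ j : ℕ, z = j • m • E.x₀ := by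
    obtain ⟨j, hj⟩ := mem_multiples_iff_mem_zmultiples.2 hz
    exact ⟨j, hj.symm⟩
  have hI : IsIdeal (AddSubgroup.zmultiples (m • E.x₀)) := by
    refine IsIdeal.of_lam_mem ⟨fun z hz b => ?_⟩ (fun b z hz => ?_) (fun z hz b => ?_)
    · obtain ⟨j, rfl⟩ := hmem hz
      rwa [hcomm, add_neg_cancel_right]
    · obtain ⟨j, rfl⟩ := hmem hz
      rwa [hlam]
    · obtain ⟨j, rfl⟩ := hmem hz
      rw [star_eq, hker, sub_self]
      exact AddSubgroup.zero_mem _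
  by_contra hne
  obtain ⟨w, hw⟩ := exists_ne (0 : W)
  obtain ⟨j, hj⟩ := hmem (E.minimal _ hI (by rwa [Ne, AddSubgroup.zmultiples_eq_bot]) w)
  rw [← mul_nsmul'] at hj
  exact hw (E.eq_zero_of_ι_eq_nsmul hj)

theorem exists_datum [Finite B] [Finite W] : ∃ (p n : ℕ) (D : Datum W p n (addOrderOf E.x₀)),
    D.A = E.A ∧ D.A' = E.A' ∧ D.v₁ = E.v₁ := by
  obtain ⟨p, n, hp, hn, hcard, hel⟩ := E.exists_prime
  obtain ⟨u₀, hu₀⟩ := E.sub_smul_bijective.2 E.v₁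
  have hu₀ : u₀ - E.A • u₀ = E.v₁ := hu₀
  have hA : orderOf E.A ∣ addOrderOf E.x₀ := orderOf_dvd_of_pow_eq_one E.A_pow_addOrderOf
  have hA' : orderOf E.A' ∣ addOrderOf E.x₀ := orderOf_dvd_of_pow_eq_one E.A'_pow_addOrderOf
  have hAp : orderOf E.A ∣ p ^ n - 1 :=
    hcard ▸ orderOf_dvd_of_mem_genRing E.isSimpleModule E.comm E.A coe_mem_genRing
  have hAp' : orderOf E.A' ∣ p ^ n - 1 :=
    hcard ▸ orderOf_dvd_of_mem_genRing E.isSimpleModule E.comm E.A' coe_mem_genRing'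
  have hdvd {m : ℕ} (h1 : E.A ^ m = 1) (h2 : E.A' ^ m = 1)
      (h3 : ∑ j ∈ Finset.range m, E.A' ^ j • E.v₁ = 0) : addOrderOf E.x₀ ∣ m :=
    addOrderOf_dvd_of_nsmul_eq_zero (E.nsmul_x₀_eq_zero h1 h2 h3)
  refine ⟨p, n,
    { A := E.A
      A' := E.A'
      u₀ := u₀
      prime := hp
      one_le_n := hn
      card_eq := hcard
      elementary := hel
      one_lt_k := ?_
      comm := E.comm
      order_A := Nat.dvd_gcd hA hAp
      order_A' := Nat.dvd_gcd hA' hAp'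
      A_ne_one := E.A_ne_one
      k_eq₁ := ?_
      k_eq₂ := ?_
      k_eq₃ := ?_
      simple := E.isSimpleModule }, rfl, rfl, hu₀⟩
  · have h0 := addOrderOf_pos E.x₀
    have h1 : addOrderOf E.x₀ ≠ 1 := by
      intro h1
      have h := E.A_pow_addOrderOf
      rw [h1, pow_one] at h
      exact E.A_ne_one h
    omega
  · intro h1 hv
    rw [hu₀] at hv
    refine Nat.dvd_antisymm (hdvd (pow_orderOf_eq_one _) (by rw [h1, one_pow]) ?_) hA
    simp [hv]
  · intro h1 hv
    rw [hu₀] at hv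
    refine Nat.dvd_antisymm (hdvd ?_ (by rw [h1, one_pow]) ?_) ?_
    · rw [pow_mul, pow_orderOf_eq_one, one_pow]
    · simp [h1, mul_smul, hel]
    · -- The order of `A` is prime to `p`, and `p` divides `k` because `k v₁ = 0`.
      have hs := E.sum_pow_addOrderOf
      simp only [h1, one_pow, one_smul, Finset.sum_const, Finset.card_range] at hs
      have hpd : addOrderOf E.v₁ = p := addOrderOf_eq_prime (hp := ⟨hp⟩) (hel _) hv
      have hpk : p ∣ addOrderOf E.x₀ := hpd ▸ addOrderOf_dvd_of_nsmul_eq_zero hs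
      refine Nat.Coprime.mul_dvd_of_dvd_of_dvd ?_ hA hpk
      refine Nat.Coprime.symm ((Nat.Prime.coprime_iff_not_dvd hp).2 fun hpo => ?_)
      have h2 : p ∣ p ^ n := dvd_pow_self p (by omega)
      have h3 : p ∣ 1 := by
        have := (Nat.dvd_sub_iff_right (Nat.one_le_pow n p hp.pos) h2).1 (hpo.trans hAp)
        exact this
      exact hp.one_lt.ne' (Nat.dvd_one.1 h3)
  · intro h1
    refine Nat.dvd_antisymm (hdvd ?_ ?_ ?_) (Nat.lcm_dvd hA hA')
    · exact orderOf_dvd_iff_pow_eq_one.1 (Nat.dvd_lcm_left _ _)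
    · exact orderOf_dvd_iff_pow_eq_one.1 (Nat.dvd_lcm_right _ _)
    · exact sum_pow_smul_eq_zero E.isSimpleModule E.comm h1
        (orderOf_dvd_iff_pow_eq_one.1 (Nat.dvd_lcm_right _ _)) _

/-- The map `(v, i) ↦ v + i x₀` is bijective because `W` and the cyclic group of `x₀` intersect
trivially and generate `(B, +)`. -/
theorem exists_addEquiv [Finite B] {p n : ℕ} (D : Datum W p n (addOrderOf E.x₀)) (hA : D.A = E.A) :
    ∃ Ψ : D.Carrier ≃+ B, ∀ a : D.Carrier, Ψ a = E.ι a.vec + a.deg • E.x₀ := by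
  have : NeZero (addOrderOf E.x₀) := ⟨(addOrderOf_pos E.x₀).ne'⟩
  let f : D.Carrier →+ B := AddMonoidHom.mk' (fun a => E.ι a.vec + a.deg • E.x₀) (by
    intro a b
    have h : (a + b).deg • E.x₀ = (a.deg + b.deg) • E.x₀ := by
      rw [nsmul_eq_nsmul_iff_modEq, Datum.Carrier.deg, Datum.Carrier.add_def, ZMod.val_add]
      exact Nat.mod_modEq _ _
    rw [h, add_nsmul, Datum.Carrier.add_def, map_add, add_assoc, add_assoc,
      ← add_assoc (a.deg • E.x₀), nsmul_add_ι, hA, add_assoc]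
    rfl)
  have hf (a : D.Carrier) : f a = E.ι a.vec + a.deg • E.x₀ := rfl
  have hinj : Function.Injective f := by
    rw [injective_iff_map_eq_zero]
    intro a ha
    have h1 : E.ι (-a.vec) = a.deg • E.x₀ := by rw [map_neg, neg_eq_iff_add_eq_zero, ← hf, ha]
    have h2 := E.eq_zero_of_ι_eq_nsmul h1
    rw [h2, map_zero] at h1
    have h3 : a.deg = 0 := Nat.eq_zero_of_dvd_of_lt (addOrderOf_dvd_of_nsmul_eq_zero h1.symm)
      (ZMod.val_lt a.idx)
    exact Datum.Carrier.ext (neg_eq_zero.1 h2) ((ZMod.val_eq_zero _).1 h3)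
  have hsurj : Function.Surjective f := by
    intro b
    obtain ⟨w, m, rfl⟩ := E.exists_eq b
    refine ⟨⟨w, m⟩, ?_⟩
    rw [hf, Datum.Carrier.deg, ZMod.val_natCast, mod_addOrderOf_nsmul]
  exact ⟨AddEquiv.ofBijective f ⟨hinj, hsurj⟩, hf⟩

theorem exists_datum_addEquiv [Finite B] [Finite W] :
    ∃ (p n k : ℕ) (D : Datum W p n k) (Φ : B ≃+ D.Carrier),
      (∀ a b : B, Φ (a * b) = D.circ (Φ a) (Φ b)) ∧ Φ E.x₀ = D.x ∧ ∀ w, Φ (E.ι w) = D.inV w := by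
  obtain ⟨p, n, D, hA, hA', hv₁⟩ := E.exists_datum
  obtain ⟨Ψ, hΨ⟩ := E.exists_addEquiv D hA
  have hx : Ψ D.x = E.x₀ := by
    rw [hΨ, D.deg_x, one_nsmul, Datum.x, map_zero, zero_add]
  have hι (w : W) : Ψ (D.inV w) = E.ι w := by
    rw [hΨ, Datum.inV, Datum.Carrier.deg, ZMod.val_zero, zero_nsmul, add_zero]
  have hlambda (a : D.Carrier) : Ψ (D.lambda a) = lam E.x₀ (Ψ a) := by
    let f : D.Carrier →+ B := Ψ.toAddMonoidHom.comp (AddMonoidHom.mk' D.lambda D.lambda_add)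
    let g : D.Carrier →+ B := (lamHom E.x₀).comp Ψ.toAddMonoidHom
    have hfx : f D.x = g D.x := by
      change Ψ (D.lambda D.x) = lam E.x₀ (Ψ D.x)
      rw [hx, Datum.x, D.lambda_mk_one, smul_zero, zero_add, ← D.inV_add_x, map_add, hι, hx, hv₁,
        E.lam_x₀]
    have hfι (w : W) : f (D.inV w) = g (D.inV w) := by
      change Ψ (D.lambda (D.inV w)) = lam E.x₀ (Ψ (D.inV w))
      rw [D.lambda_inV, hι, hι, ← E.ι_A', hA']
    change f a = g a
    rw [D.eq_inV_add_nsmul a, map_add, map_add, map_nsmul, map_nsmul, hfx, hfι]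
  have hcirc (a b : D.Carrier) : Ψ (D.circ a b) = Ψ a * Ψ b := by
    have h : Ψ (D.lambda^[a.deg] b) = (lam E.x₀)^[a.deg] (Ψ b) :=
      Function.Semiconj.iterate_right (f := Ψ) hlambda a.deg b
    rw [Datum.circ, map_add, mul_eq_add_lam, h, hΨ a, E.lam_add_left, E.lam_ι, lam_nsmul_x₀]
  refine ⟨p, n, _, D, Ψ.symm, fun a b => ?_, ?_, fun w => ?_⟩
  · rw [AddEquiv.symm_apply_eq, hcirc, Ψ.apply_symm_apply, Ψ.apply_symm_apply]
  · rw [AddEquiv.symm_apply_eq, hx]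
  · rw [AddEquiv.symm_apply_eq, hι]

end

end LinearBrace

/-! ### Coordinates from a transitive minimal ideal -/

section TypeTwo

variable {B : Type u} [AddGroup B] [SkewLeftBrace B] {X : Set B} {V : AddSubgroup B}

/-- As `V` acts trivially through `λ`, its orbit on `X` is a `V`-conjugacy class. -/
theorem IsTypeTwo.eq_conj (hT : IsTypeTwo X V) (hl : ∀ v ∈ V, ∀ b, lam v b = b) {x₀ : B}
    (hx₀ : x₀ ∈ X) : X = {y | ∃ v ∈ V, y = v + x₀ - v} := by
  ext y
  constructor
  · intro hy
    obtain ⟨a, ha, b, hb, h⟩ := hT.transitive.trans x₀ hx₀ y hy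
    refine ⟨-a, V.neg_mem ha, ?_⟩
    rw [← h, hl b hb, sig, sub_neg_eq_add]
  · rintro ⟨v, hv, rfl⟩
    have h := hT.transitive.mem (-v) (V.neg_mem hv) 0 V.zero_mem x₀ hx₀
    rwa [lam_zero_left, sig, neg_neg, ← sub_eq_add_neg] at h

omit [SkewLeftBrace B] in
theorem exists_add_nsmul [Finite B] (hn : V.Normal) {x₀ : B}
    (hX : X = {y | ∃ v ∈ V, y = v + x₀ - v}) (hgen : AddSubgroup.closure X = ⊤) (b : B) :
    ∃ v ∈ V, ∃ m : ℕ, b = v + m • x₀ := by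
  have hle : AddSubgroup.closure X ≤ V ⊔ AddSubgroup.zmultiples x₀ := by
    rw [AddSubgroup.closure_le, hX]
    rintro _ ⟨v, hv, rfl⟩
    have h1 : v ∈ V ⊔ AddSubgroup.zmultiples x₀ := AddSubgroup.mem_sup_left hv
    have h2 : x₀ ∈ V ⊔ AddSubgroup.zmultiples x₀ :=
      AddSubgroup.mem_sup_right (AddSubgroup.mem_zmultiples x₀)
    exact AddSubgroup.sub_mem _ (AddSubgroup.add_mem _ h1 h2) h1
  have hb : b ∈ ((V ⊔ AddSubgroup.zmultiples x₀ : AddSubgroup B) : Set B) :=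
    hle (hgen ▸ AddSubgroup.mem_top b)
  rw [AddSubgroup.normal_add] at hb
  obtain ⟨v, hv, z, hz, rfl⟩ := hb
  obtain ⟨m, rfl⟩ := mem_multiples_iff_mem_zmultiples.2 hz
  exact ⟨v, hv, m, rfl⟩

theorem exists_unit_of_injective {W : Type u} [AddCommGroup W] [Finite W] (f : W →+ W)
    (hf : Function.Injective f) : ∃ C : Aut W, ∀ w, C • w = f w := by
  let e : W ≃+ W := AddEquiv.ofBijective f ⟨hf, Finite.surjective_of_injective hf⟩
  refine ⟨⟨e.toAddMonoidHom, e.symm.toAddMonoidHom, ?_, ?_⟩, fun w => rfl⟩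
  · exact AddMonoidHom.ext e.apply_symm_apply
  · exact AddMonoidHom.ext e.symm_apply_apply

omit [SkewLeftBrace B] in
/-- An automorphism of a group induces a unit of the endomorphism ring of each finite abelian
subgroup that it maps into itself. -/
theorem exists_unit_of_mapsTo {W : Type u} [AddCommGroup W] [Finite W] (ι : W →+ B)
    (hι : Function.Injective ι) (f : B →+ B) (hf : Function.Injective f)
    (hm : ∀ w, ∃ w', ι w' = f (ι w)) : ∃ C : Aut W, ∀ w, ι (C • w) = f (ι w) := by
  choose g hg using hm
  obtain ⟨C, hC⟩ := exists_unit_of_injective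
    (AddMonoidHom.mk' g fun a b => hι (by rw [map_add, hg, hg, hg, map_add, map_add]))
    (fun a b h => hι (hf (by rw [← hg, ← hg]; exact congrArg ι h)))
  exact ⟨C, fun w => by rw [hC, ← hg]; rfl⟩

theorem IsTypeTwo.exists_datum [Finite B] (hT : IsTypeTwo X V) [hX : Nontrivial X]
    (h3 : B3 B = ⊥) (hcomm : ∀ v ∈ V, ∀ w ∈ V, v + w = w + v) {x₀ : B} (hx₀ : x₀ ∈ X) :
    ∃ (W : Type u) (_ : AddCommGroup W) (p n k : ℕ) (D : Datum W p n k) (Φ : B ≃+ D.Carrier),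
      (∀ a b : B, Φ (a * b) = D.circ (Φ a) (Φ b)) ∧ Φ x₀ = D.x ∧
      Φ '' (V : Set B) = Set.range D.inV ∧ Φ '' X = D.X := by
  have hn : V.Normal := hT.smallest.isIdeal.normal
  have hl : ∀ v ∈ V, ∀ b, lam v b = b := fun v hv b => hT.smallest.lam_eq h3 hv b
  have hXeq := hT.eq_conj hl hx₀
  let _ : AddCommGroup V :=
    { (inferInstance : AddGroup V) with
      add_comm := fun a b => Subtype.ext (hcomm a a.2 b b.2) }
  let ι : V →+ B := V.subtype
  have hι : Function.Injective ι := Subtype.val_injective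
  have hιV {b : B} (hb : b ∈ V) : ∃ w, ι w = b := ⟨⟨b, hb⟩, rfl⟩
  have : Nontrivial V := (AddSubgroup.nontrivial_iff_ne_bot V).2 hT.smallest.ne_bot
  obtain ⟨A, hA⟩ := exists_unit_of_mapsTo ι hι
    (AddMonoidHom.mk' (fun b => x₀ + b - x₀) fun a b => by simp [sub_eq_add_neg, add_assoc])
    (fun a b h => by simpa using h)
    (fun w => hιV ((sub_eq_add_neg (x₀ + ι w) x₀) ▸ hn.conj_mem _ w.2 x₀))
  obtain ⟨A', hA'⟩ := exists_unit_of_mapsTo ι hι (lamHom x₀)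
    (fun a b h => by
      have h : x₀ + lam x₀ a = x₀ + lam x₀ b := congrArg (x₀ + ·) h
      rw [← mul_eq_add_lam, ← mul_eq_add_lam] at h
      exact mul_left_cancel h)
    (fun w => hιV ((hT.smallest.isIdeal.lam_mem x₀).subset ⟨_, w.2, rfl⟩))
  have hA (w : V) : ι (A • w) = x₀ + ι w - x₀ := hA w
  obtain ⟨v₁, hv₁⟩ : ∃ v₁, ι v₁ = lam x₀ x₀ - x₀ := by
    apply hιV
    have h := (hT.restricts x₀ hx₀ x₀ hx₀).1
    rw [hXeq] at h
    obtain ⟨v, hv, h⟩ := h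
    have h : lam x₀ x₀ = v + x₀ - v := h
    rw [h]
    have h1 : v + x₀ - v - x₀ = v + (x₀ + -v + -x₀) := by simp [sub_eq_add_neg, add_assoc]
    rw [h1]
    exact V.add_mem hv (hn.conj_mem _ (V.neg_mem hv) x₀)
  have hA1 : A ≠ 1 := by
    intro hA1
    -- Otherwise `V` centralizes `x₀`, and its orbit `X` is a point.
    have hfix (y : B) (hy : y ∈ X) : y = x₀ := by
      rw [hXeq] at hy
      obtain ⟨v, hv, rfl⟩ := hy
      have h := hA ⟨v, hv⟩
      rw [hA1, one_smul] at h
      have h : v = x₀ + v - x₀ := h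
      rw [sub_eq_iff_eq_add, eq_sub_iff_add_eq.1 h]
    obtain ⟨a, b, hab⟩ := hX
    exact hab (Subtype.ext ((hfix a a.2).trans (hfix b b.2).symm))
  let E : LinearBrace B V :=
    { ι := ι
      x₀ := x₀
      A := A
      A' := A'
      v₁ := v₁
      ι_injective := hι
      ι_A := hA
      ι_A' := hA'
      lam_ι := fun w b => hl w w.2 b
      lam_add_left := lam_add_left hn hl hT.quot_trivial
      lam_x₀ := by rw [hv₁, sub_add_cancel]
      exists_eq := fun b => by
        obtain ⟨v, hv, m, rfl⟩ := exists_add_nsmul hn hXeq hT.generates b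
        exact ⟨⟨v, hv⟩, m, rfl⟩
      minimal := fun I hI h0 w => hT.smallest.le I hI h0 w.2
      A_ne_one := hA1 }
  obtain ⟨p, n, k, D, Φ, hΦ, hΦx, hΦι⟩ := E.exists_datum_addEquiv
  have hΦx : Φ x₀ = D.x := hΦx
  have hΦι (v : B) (hv : v ∈ V) : Φ v = D.inV ⟨v, hv⟩ := hΦι ⟨v, hv⟩
  refine ⟨V, _, p, n, k, D, Φ, hΦ, hΦx, ?_, ?_⟩
  · ext a
    constructor
    · rintro ⟨v, hv, rfl⟩
      exact ⟨⟨v, hv⟩, (hΦι v hv).symm⟩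
    · rintro ⟨⟨v, hv⟩, rfl⟩
      exact ⟨v, hv, hΦι v hv⟩
  · ext a
    rw [hXeq]
    constructor
    · rintro ⟨_, ⟨v, hv, rfl⟩, rfl⟩
      exact ⟨⟨v, hv⟩, by rw [map_sub, map_add, hΦι v hv, hΦx]⟩
    · rintro ⟨⟨v, hv⟩, rfl⟩
      exact ⟨_, ⟨v, hv, rfl⟩, by rw [map_sub, map_add, hΦι v hv, hΦx]⟩

end TypeTwo

end YBE

theorem mainTheorem5 :
    (∀ (V : Type u) [AddCommGroup V] (p n k : ℕ) (D : YBE.Datum V p n k),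
      (IsField (YBE.genRing D.A D.A') ∧ Nat.card (YBE.genRing D.A D.A') = p ^ n) ∧
      ∃ _ : YBE.SkewLeftBrace D.Carrier,
        (∀ a b : D.Carrier, a * b = D.circ a b) ∧
        D.X = {a | ∃ g : D.Carrier, a = g + D.x - g} ∧
        D.X = {a | ∃ v : V, a = D.inV v + D.x} ∧
        D.X.Finite ∧
        (∃ (hX : YBE.RestrictsTo YBE.rB D.X)
          (h : YBE.IsNondegSolution (YBE.restr YBE.rB hX)),
          YBE.IsIrretractable h ∧ YBE.IsSimpleSolution (YBE.restr YBE.rB hX)) ∧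
        ∀ v w : V, YBE.rB (D.inV v + D.x, D.inV w + D.x) =
          (D.inV (D.A' • w + D.v₁) + D.x,
            D.inV (-(D.A⁻¹ • w) + (D.A * D.A')⁻¹ • (v - D.v₁) + w) + D.x)) ∧
    (∀ (B : Type u) [AddGroup B] [YBE.SkewLeftBrace B] [Finite B] (X : Set B) (V : AddSubgroup B)
      (hT : YBE.IsTypeTwo X V), YBE.IsSimpleSolution (YBE.restr YBE.rB hT.restricts) →
      YBE.B3 B = ⊥ → (∀ v ∈ V, ∀ w ∈ V, v + w = w + v) →
      ∀ x₀ ∈ X, ∃ (W : Type u) (_ : AddCommGroup W) (p n k : ℕ) (D : YBE.Datum W p n k)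
        (Φ : B ≃+ D.Carrier),
        (∀ a b : B, Φ (a * b) = D.circ (Φ a) (Φ b)) ∧
        Φ x₀ = D.x ∧
        Φ '' (V : Set B) = Set.range D.inV ∧
        Φ '' X = D.X) := by
  refine ⟨fun V _ p n k D => ⟨⟨YBE.genRing_isField D.simple D.comm, ?_⟩, D.skewLeftBrace,
    D.mul_eq_circ, D.X_eq_conj, D.X_eq_inV_add, D.X_finite,
    ⟨D.restrictsTo_X, D.isNondegSolution, D.isIrretractable, D.isSimpleSolution⟩,
    D.rB_inV_add_x⟩, ?_⟩
  · rw [YBE.card_genRing D.simple D.comm, D.card_eq]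
  · intro B _ _ _ X V hT hS h3 hcomm x₀ hx₀
    have := hS.nontrivial
    exact hT.exists_datum h3 hcomm hx₀
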